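/- Let $\mathcal U$ be a selective ultrafilter on $\omega$, i.e. a free ultrafilter such that for every partition $\{A_n : n\in\omega\}$ of $\omega$ into non-empty sets either $A_n\in\mathcal U$ for some $n$, or there are $a_n\in A_n$ ($n\in\omega$) with $\{a_n : n\in\omega\}\in\mathcal U$. Let $\mathfrak c$ be the cardinality of the continuum, identified with its initial ordinal; let $\mathbb Z^{(\mathfrak c)}$ be the group of finitely supported functions $\mathfrak c\to\mathbb Z$ (the free Abelian group of size continuum), let $\chi_\xi\in\mathbb Z^{(\mathfrak c)}$ be the characteristic function of $\{\xi\}$, and let $\mathbb T=\mathbb R/\mathbb Z$. A point $x$ of a topological space is a $\mathcal U$-limit of a sequence $(x_n)_{n\in\omega}$ if $\{n : x_n\in V\}\in\mathcal U$ for every neighbourhood $V$ of $x$. Then $\mathbb Z^{(\mathfrak c)}$ has a countably compact Hausdorff group topology. More precisely: 1. There is an enumeration $(h_\xi)_{0<\xi<\mathfrak c}$ of all injective sequences $\omega\to\mathbb Z^{(\mathfrak c)}$ such that $\bigcup_{n\in\omega}\operatorname{supp} h_\xi(n)\subseteq\xi$ for every $0<\xi<\mathfrak c$. 2. For every such enumeration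 (possibly with repetitions) there are permutations $\sigma_\xi$ of $\omega$ ($0<\xi<\mathfrak c$) such that, in the rational vector space $(\mathbb Q^{(\mathfrak c)})^{\omega}/\mathcal U$, the classes of the sequences $h_\xi\circ\sigma_\xi$ ($0<\xi<\mathfrak c$) together with the classes of the constant sequences with value $\chi_\beta$ ($\beta<\mathfrak c$) form a linearly independent family. 3. For every such enumeration $(h_\xi)$ and all permutations $(\sigma_\xi)$ with the independence property of 2, there are group homomorphisms $\varphi_J:\mathbb Z^{(\mathfrak c)}\to\mathbb T$, one for each $J\in\mathbb Z^{(\mathfrak c)}\setminus\{0\}$, such that (i) $\varphi_J(J)\ne 0$ for every $J\neq 0$; (ii) $\varphi_J(\chi_\xi)$ is the $\mathcal U$-limit of $(\varphi_J(h_\xi(\sigma_\xi(n))))_{n\in\omega}$ for every $J\neq0$ and every $0<\xi<\mathfrak c$; (iii) the initial topology on $\mathbb Z^{(\mathfrak c)}$ induced by the family $(\varphi_J)_{J\ne0}$ is a countably compact Hausdorff group topology, and in this topology $\chi_\xi$ is a $\mathcal U$-limit of the sequence $h_\xi\circ\sigma_\xi$ for every $0<\xi<\mathfrak c$. -/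

import Mathlib

open Filter Topology

/-- The set of ordinals smaller than the initial ordinal `𝔠`, as a well-ordered type. -/
abbrev ContIdx : Type := Cardinal.continuum.{0}.ord.ToType

/-- The nonzero ordinals smaller than `𝔠`: those that are not the least element. -/
abbrev ContIdxPos : Type := {ξ : ContIdx // ¬ IsMin ξ}

/-- The free Abelian group `ℤ^(𝔠)` of size continuum: finitely supported functions `𝔠 → ℤ`. -/
abbrev FreeAbCont : Type := ContIdx →₀ ℤ

/-- The characteristic function `χ_ξ`, with value `1` at `ξ` and `0` elsewhere. -/
noncomputable def chi (ξ : ContIdx) : FreeAbCont := Finsupp.single ξ 1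

/-- A selective ultrafilter on `ω`: it is free, and for each partition `{A n : n ∈ ω}` of `ω` into
non-empty sets either some `A n` belongs to it, or it contains the range of a choice of one point
of each `A n`. -/
def IsSelective (U : Ultrafilter ℕ) : Prop :=
  (U : Filter ℕ) ≤ cofinite ∧
    ∀ A : ℕ → Set ℕ, (∀ n, (A n).Nonempty) → Pairwise (fun m n => Disjoint (A m) (A n)) →
      (⋃ n, A n) = Set.univ →
        (∃ n, A n ∈ U) ∨ ∃ a : ℕ → ℕ, (∀ n, a n ∈ A n) ∧ Set.range a ∈ U

/-- `(h ξ : 0 < ξ < 𝔠)` enumerates all injective sequences in `ℤ^(𝔠)`, in such a way that the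
supports of all terms of `h ξ` are contained in `ξ = {β : β < ξ}`. -/
def IsInjSeqEnumeration (h : ContIdxPos → ℕ → FreeAbCont) : Prop :=
  Set.range h = {f : ℕ → FreeAbCont | Function.Injective f} ∧
    ∀ (ξ : ContIdxPos) (n : ℕ), ∀ β ∈ (h ξ n).support, β < ξ.1

/-- The class in the ultrapower `(ℚ^(𝔠))^ω / U` of a sequence in `ℤ^(𝔠)`. -/
noncomputable def ultraClass (U : Ultrafilter ℕ) (f : ℕ → FreeAbCont) :
    (U : Filter ℕ).Germ (ContIdx →₀ ℚ) :=
  ((fun n => (f n).mapRange (Int.cast : ℤ → ℚ) Int.cast_zero : ℕ → ContIdx →₀ ℚ) :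
    (U : Filter ℕ).Germ (ContIdx →₀ ℚ))

/-- The classes of the sequences `h ξ ∘ σ ξ` (`0 < ξ < 𝔠`) and of the constant sequences `χ_β`
(`β < 𝔠`) are linearly independent in the rational vector space `(ℚ^(𝔠))^ω / U`. -/
def IsIndependentFamily (U : Ultrafilter ℕ) (h : ContIdxPos → ℕ → FreeAbCont)
    (σ : ContIdxPos → Equiv.Perm ℕ) : Prop :=
  LinearIndependent ℚ
    (Sum.elim (fun ξ : ContIdxPos => ultraClass U (h ξ ∘ σ ξ))
      (fun β : ContIdx => ultraClass U (fun _ => chi β)))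

/-- The initial topology on `ℤ^(𝔠)` induced by a family of homomorphisms into `𝕋 = ℝ / ℤ`. -/
noncomputable abbrev initialTopology {ι : Type} (φ : ι → FreeAbCont →+ UnitAddCircle) :
    TopologicalSpace FreeAbCont :=
  ⨅ i, TopologicalSpace.induced (φ i) inferInstance

/-- The topology `τ` makes `ℤ^(𝔠)` a countably compact Hausdorff topological group. -/
structure IsCountablyCompactGroupTopology (τ : TopologicalSpace FreeAbCont) : Prop where
  isTopologicalAddGroup : @IsTopologicalAddGroup FreeAbCont τ _
  t2Space : @T2Space FreeAbCont τ
  countablyCompactSpace : @CountablyCompactSpace FreeAbCont τ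

/-! The topology is induced by characters `φ_J`, each nonzero at `J`, along which every injective
sequence, suitably permuted, `U`-converges to some `χ_ξ`. The first property gives Hausdorffness;
the second gives every infinite set an accumulation point, hence countable compactness.

To build `φ_J`, note that by independence each nontrivial integer relation among the vectors
`h_ξ(σ_ξ(n))` and `χ_β` fails for `U`-almost all `n`. A uniform Kronecker theorem
(`eventually_forall_exists_norm_linearCombination_sub_lt`) then lets finitely many of them take
almost arbitrary values in the circle for almost all `n`. Selectivity
(`IsSelective.exists_mem_forall_lt_mem`) provides one set in `U` along which these approximations
can be chained. The resulting Cauchy sequence of partial characters has a limit on a countable set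
containing the support of `J` and closed under the supports of the sequences involved
(`IsSelective.exists_tendsto_linearCombination_on`). Supports of `h_ξ` lie below `ξ`, so the
remaining values are defined by recursion as `U`-limits, which exist by compactness.

The enumeration and the permutations come from cardinal arithmetic: `𝔠` has uncountable cofinality,
and `𝔠` almost disjoint permutations give `𝔠` distinct classes, too many for a span of fewer than
`𝔠` vectors. -/

/-! ### Uniform Kronecker approximation by Fourier analysis on tori. -/

section Kronecker

open MeasureTheory UnitAddTorus

theorem mFourier_apply_eq_toCircle {ι : Type*} [Fintype ι] (c : ι → ℤ) (y : UnitAddTorus ι) :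
    mFourier c y = (AddCircle.toCircle (∑ i, c i • y i) : ℂ) := by
  have key : ∀ s : Finset ι,
      ∏ i ∈ s, fourier (c i) (y i) = (AddCircle.toCircle (∑ i ∈ s, c i • y i) : ℂ) := by
    classical
    intro s
    induction s using Finset.induction_on with
    | empty => simp
    | insert a s ha ih =>
      rw [Finset.prod_insert ha, Finset.sum_insert ha, ih, AddCircle.toCircle_add, fourier_apply]
      simp
  exact key Finset.univ

theorem mFourier_add_apply {ι : Type*} [Fintype ι] (c : ι → ℤ) (y z : UnitAddTorus ι) :
    mFourier c (y + z) = mFourier c y * mFourier c z := by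
  simp [mFourier_apply_eq_toCircle, smul_add, Finset.sum_add_distrib, AddCircle.toCircle_add]

/-- A character of a compact group other than the trivial one has integral zero over each
translate. -/
theorem integral_mFourier_comp_sub_eq_zero {ι K : Type*} [Fintype ι] [AddCommGroup K]
    [MeasurableSpace K] [MeasurableAdd K] (μ : Measure K) [μ.IsAddLeftInvariant]
    (L : K →+ UnitAddTorus ι) (c : ι → ℤ) (y : UnitAddTorus ι)
    (hc : ∃ x, mFourier c (L x) ≠ 1) : ∫ x, mFourier c (L x - y) ∂μ = 0 := by
  obtain ⟨x₀, hx₀⟩ := hc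
  have h : ∫ x, mFourier c (L x - y) ∂μ = mFourier c (L x₀) * ∫ x, mFourier c (L x - y) ∂μ := by
    rw [← integral_const_mul, ← integral_add_left_eq_self _ x₀]
    refine integral_congr_ae (ae_of_all _ fun x => ?_)
    simp only [map_add, add_sub_assoc, mFourier_add_apply]
  have h2 : (mFourier c (L x₀) - 1) * ∫ x, mFourier c (L x - y) ∂μ = 0 := by
    rw [sub_mul, one_mul, ← h, sub_self]
  exact (mul_eq_zero.1 h2).resolve_left (sub_ne_zero.2 hx₀)

/-- Only the constant term survives integration. The right side depends neither on `L` nor on `y`,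
so the average along `L` can be compared with the average over the whole torus. -/
theorem integral_trigPolynomial_comp_sub {ι K : Type*} [Fintype ι] [AddCommGroup K]
    [TopologicalSpace K] [CompactSpace K] [IsTopologicalAddGroup K]
    [MeasurableSpace K] [BorelSpace K] (μ : Measure K) [μ.IsAddLeftInvariant]
    [IsProbabilityMeasure μ] (L : K →+ UnitAddTorus ι) (hL : Continuous L)
    (p : (ι → ℤ) →₀ ℂ) (y : UnitAddTorus ι)
    (hc : ∀ c ∈ p.support, c ≠ 0 → ∃ x, mFourier c (L x) ≠ 1) :
    ∫ x, (p.sum fun c a => a • mFourier c) (L x - y) ∂μ = p 0 := by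
  classical
  have hint : ∀ c : ι → ℤ, Integrable (fun x => mFourier c (L x - y)) μ := fun c =>
    Continuous.integrable_of_hasCompactSupport (by fun_prop) (HasCompactSupport.of_compactSpace _)
  simp only [Finsupp.sum, ContinuousMap.coe_sum, Finset.sum_apply, ContinuousMap.coe_smul,
    Pi.smul_apply, smul_eq_mul]
  rw [integral_finsetSum _ fun c _ => (hint c).const_mul _]
  simp only [integral_const_mul]
  rw [Finset.sum_eq_single 0]
  · simp [mFourier_zero]
  · intro c hcs hc0
    rw [integral_mFourier_comp_sub_eq_zero μ L c y (hc c hcs hc0), mul_zero]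
  · intro h
    simp [Finsupp.notMem_support_iff.1 h]

theorem exists_zsmul_eq_half {d : ℤ} (hd : d ≠ 0) :
    ∃ t : UnitAddCircle, d • t = ((1 / 2 : ℝ) : UnitAddCircle) := by
  refine ⟨((1 / (2 * d) : ℝ) : UnitAddCircle), ?_⟩
  rw [← AddCircle.coe_zsmul]
  congr 1
  have : (d : ℝ) ≠ 0 := by exact_mod_cast hd
  rw [zsmul_eq_mul]
  field_simp

theorem norm_coe_half : ‖((1 / 2 : ℝ) : UnitAddCircle)‖ = 1 / 2 := by
  rw [UnitAddCircle.norm_eq]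
  norm_num [round_eq]

theorem exists_mFourier_ne_one {ι : Type*} [Fintype ι] {c : ι → ℤ} (hc : c ≠ 0) :
    ∃ x : UnitAddTorus ι, mFourier c x ≠ 1 := by
  classical
  obtain ⟨i, hi⟩ := Function.ne_iff.1 hc
  obtain ⟨t, ht⟩ := exists_zsmul_eq_half hi
  refine ⟨Pi.single i t, fun h => ?_⟩
  rw [mFourier_apply_eq_toCircle] at h
  have h1 : AddCircle.toCircle (∑ j, c j • (Pi.single i t : UnitAddTorus ι) j)
      = AddCircle.toCircle (0 : UnitAddCircle) := by
    apply Subtype.ext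
    simpa using h
  have h2 := AddCircle.injective_toCircle one_ne_zero h1
  rw [Finset.sum_eq_single i (fun j _ hj => by simp [hj]) (by simp), Pi.single_eq_same, ht] at h2
  have := norm_coe_half
  rw [h2] at this
  norm_num at this

/-- Evaluation of finitely supported integer functions at the points of a torus. -/
noncomputable def torusEval {X ι : Type*} (v : ι → X →₀ ℤ) :
    (X → UnitAddCircle) →+ UnitAddTorus ι where
  toFun x i := Finsupp.linearCombination ℤ x (v i)
  map_zero' := by
    ext i
    simp
  map_add' x y := by
    ext i
    simp [Finsupp.linearCombination_apply, Finsupp.sum, smul_add, Finset.sum_add_distrib]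

theorem continuous_linearCombination_fun {X : Type*} (f : X →₀ ℤ) :
    Continuous fun x : X → UnitAddCircle => Finsupp.linearCombination ℤ x f := by
  simp only [Finsupp.linearCombination_apply, Finsupp.sum]
  fun_prop

theorem exists_linearCombination_eq_half {X : Type*} {f : X →₀ ℤ} (hf : f ≠ 0) :
    ∃ x : X → UnitAddCircle, Finsupp.linearCombination ℤ x f = ((1 / 2 : ℝ) : UnitAddCircle) := by
  classical
  obtain ⟨e, he⟩ := Finsupp.ne_iff.1 hf
  obtain ⟨t, ht⟩ := exists_zsmul_eq_half he
  refine ⟨Pi.single e t, ?_⟩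
  rw [Finsupp.linearCombination_apply, Finsupp.sum,
    Finset.sum_eq_single e (fun j _ hj => by simp [hj]), Pi.single_eq_same, ht]
  intro h
  rw [Finsupp.notMem_support_iff.1 h, zero_smul]

/-- The character with frequency `c` pulls back along `torusEval v` to the pairing with `∑ i, c i •
v i`, which can be given the value `1 / 2`. -/
theorem exists_mFourier_torusEval_ne_one {X ι : Type*} [Fintype ι] (v : ι → X →₀ ℤ) {c : ι → ℤ}
    (hc : ∑ i, c i • v i ≠ 0) : ∃ x, mFourier c (torusEval v x) ≠ 1 := by
  obtain ⟨x, hx⟩ := exists_linearCombination_eq_half hc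
  refine ⟨x, fun h => ?_⟩
  rw [mFourier_apply_eq_toCircle] at h
  have h1 : AddCircle.toCircle (∑ i, c i • torusEval v x i)
      = AddCircle.toCircle (0 : UnitAddCircle) := by
    apply Subtype.ext
    simpa using h
  have h2 := AddCircle.injective_toCircle one_ne_zero h1
  have h3 : ∑ i, c i • torusEval v x i = Finsupp.linearCombination ℤ x (∑ i, c i • v i) := by
    simp [torusEval, map_sum]
  rw [h3, hx] at h2
  have := norm_coe_half
  rw [h2] at this
  norm_num at this

/-- A uniform form of Kronecker's approximation theorem: finitely many sequences of integer vectors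
without a linear relation that holds frequently take approximately arbitrary values
in the circle, eventually. -/
theorem eventually_forall_exists_norm_linearCombination_sub_lt {X ι N : Type*} [Fintype ι]
    {l : Filter N} (v : ι → N → X →₀ ℤ)
    (h : ∀ c : ι → ℤ, c ≠ 0 → ∀ᶠ n in l, ∑ i, c i • v i n ≠ 0) {ε : ℝ} (hε : 0 < ε) :
    ∀ᶠ n in l, ∀ y : ι → UnitAddCircle, ∃ x : X → UnitAddCircle,
      ∀ i, ‖Finsupp.linearCombination ℤ x (v i n) - y i‖ < ε := by
  classical
  -- A bump function vanishing outside the open `ε`-ball around `0`.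
  let g : C(UnitAddTorus ι, ℝ) := ⟨fun z => max 0 (ε - ‖z‖), by fun_prop⟩
  let g' : C(UnitAddTorus ι, ℂ) := ⟨fun z => (g z : ℂ), by fun_prop⟩
  let : MeasurableSpace (UnitAddTorus ι) := borel _
  have : BorelSpace (UnitAddTorus ι) := ⟨rfl⟩
  let : MeasurableSpace (X → UnitAddCircle) := borel _
  have : BorelSpace (X → UnitAddCircle) := ⟨rfl⟩
  let ν : Measure (UnitAddTorus ι) := Measure.addHaarMeasure ⊤
  let μ : Measure (X → UnitAddCircle) := Measure.addHaarMeasure ⊤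
  have : IsProbabilityMeasure ν := ⟨Measure.addHaarMeasure_self (K₀ := ⊤)⟩
  have : IsProbabilityMeasure μ := ⟨Measure.addHaarMeasure_self (K₀ := ⊤)⟩
  have hI : 0 < ∫ z, g z ∂ν := by
    refine g.continuous.integral_pos_of_hasCompactSupport_nonneg_nonzero
      (HasCompactSupport.of_compactSpace _) (fun z => le_max_left _ _) (x := 0) ?_
    simp [g, hε.ne', hε.le]
  set I := ∫ z, g z ∂ν
  have hI' : ∫ z, g' z ∂ν = (I : ℂ) := integral_ofReal
  have hcl : g' ∈ closure (Submodule.span ℂ (Set.range (mFourier (d := ι))) : Set _) := by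
    have := span_mFourier_closure_eq_top (d := ι)
    rw [← Submodule.topologicalClosure_coe, this]
    trivial
  obtain ⟨P, hP, hgP⟩ := Metric.mem_closure_iff.1 hcl (I / 2) (half_pos hI)
  obtain ⟨p, rfl⟩ := Finsupp.mem_span_range_iff_exists_finsupp.1 hP
  set P : C(UnitAddTorus ι, ℂ) := p.sum fun c a => a • mFourier c
  have hgP' : ∀ z, ‖g' z - P z‖ ≤ dist g' P := fun z => by
    rw [← dist_eq_norm]
    exact ContinuousMap.dist_apply_le_dist z
  -- The polynomial depends only on `ε`, and only its finitely many frequencies matter. Hence one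
  -- set of `n` serves all targets `y`.
  have hev : ∀ᶠ n in l, ∀ c ∈ p.support, c ≠ 0 → ∑ i, c i • v i n ≠ 0 := by
    rw [Filter.eventually_all_finset]
    intro c _
    by_cases hc : c = 0
    · simp [hc]
    · exact (h c hc).mono fun n hn _ => hn
  filter_upwards [hev] with n hn y
  -- If `L x - y` never enters the `ε`-ball, the bump vanishes along it, so the average of `P`
  -- there, which is `p 0`, has norm below `I / 2`. But `p 0` is also the mean of `P` over the
  -- torus, at distance below `I / 2` from `I`.
  by_contra! hcon
  have hLc : Continuous (torusEval fun i => v i n) :=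
    continuous_pi fun i => continuous_linearCombination_fun (v i n)
  have e1 : ∫ x, P (torusEval (fun i => v i n) x - y) ∂μ = p 0 :=
    integral_trigPolynomial_comp_sub μ _ hLc p y
      fun c hc hc0 => exists_mFourier_torusEval_ne_one _ (hn c hc hc0)
  have e2 : ∫ z, P (AddMonoidHom.id _ z - 0) ∂ν = p 0 :=
    integral_trigPolynomial_comp_sub ν _ continuous_id p 0
      fun c _ hc0 => exists_mFourier_ne_one hc0
  simp only [AddMonoidHom.id_apply, sub_zero] at e2
  have b1 : ‖∫ x, P (torusEval (fun i => v i n) x - y) ∂μ‖ ≤ dist g' P := by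
    have := norm_integral_le_of_norm_le_const (μ := μ) (C := dist g' P)
      (f := fun x => P (torusEval (fun i => v i n) x - y)) (ae_of_all _ fun x => ?_)
    · simpa using this
    · have hz : g' (torusEval (fun i => v i n) x - y) = 0 := by
        obtain ⟨i, hi⟩ := hcon x
        have : ε ≤ ‖torusEval (fun i => v i n) x - y‖ :=
          hi.trans (norm_le_pi_norm (torusEval (fun i => v i n) x - y) i)
        simp [g', g, this]
      have := hgP' (torusEval (fun i => v i n) x - y)
      rwa [hz, zero_sub, norm_neg] at this
  have b2 : ‖∫ z, (g' z - P z) ∂ν‖ ≤ dist g' P := by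
    simpa using norm_integral_le_of_norm_le_const (μ := ν) (C := dist g' P) (ae_of_all _ hgP')
  rw [integral_sub
    (g'.continuous.integrable_of_hasCompactSupport (HasCompactSupport.of_compactSpace _))
    (P.continuous.integrable_of_hasCompactSupport (HasCompactSupport.of_compactSpace _)),
    e2, hI'] at b2
  rw [e1] at b1
  have b3 : ‖(I : ℂ)‖ ≤ ‖(I : ℂ) - p 0‖ + ‖p 0‖ := by
    simpa using norm_add_le ((I : ℂ) - p 0) (p 0)
  rw [Complex.norm_real, Real.norm_of_nonneg hI.le] at b3
  linarith

end Kronecker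

/-! ### Combinatorics of selective ultrafilters. -/

section Selective

theorem IsSelective.exists_fiber_mem_or_injOn {U : Ultrafilter ℕ} (hU : IsSelective U)
    (p : ℕ → ℕ) : (∃ m, p ⁻¹' {m} ∈ U) ∨ ∃ B ∈ U, Set.InjOn p B := by
  by_cases hfin : (Set.range p).Finite
  · left
    have h : (⋃ m ∈ Set.range p, p ⁻¹' {m}) ∈ U := by
      rw [Set.biUnion_preimage_singleton, Set.preimage_range]
      exact Filter.univ_mem
    obtain ⟨m, -, hm⟩ := (Ultrafilter.finite_biUnion_mem_iff hfin).1 h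
    exact ⟨m, hm⟩
  · have hinf : (Set.range p).Infinite := hfin
    have : Infinite (Set.range p) := hinf.to_subtype
    obtain ⟨e⟩ : Nonempty (ℕ ≃ Set.range p) := nonempty_equiv_of_countable
    have hne : ∀ n, (p ⁻¹' {(e n : ℕ)}).Nonempty := fun n => (e n).2
    have hdisj : Pairwise fun m n => Disjoint (p ⁻¹' {(e m : ℕ)}) (p ⁻¹' {(e n : ℕ)}) := by
      intro m n hmn
      rw [Set.disjoint_left]
      intro k (hk : p k = e m) (hk' : p k = e n)
      exact hmn (e.injective (Subtype.ext (hk.symm.trans hk')))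
    have hunion : ⋃ n, p ⁻¹' {(e n : ℕ)} = Set.univ :=
      Set.eq_univ_of_forall fun k => Set.mem_iUnion.2 ⟨e.symm ⟨p k, k, rfl⟩, by simp⟩
    rcases hU.2 _ hne hdisj hunion with ⟨n, hn⟩ | ⟨a, ha, haU⟩
    · exact .inl ⟨_, hn⟩
    · refine .inr ⟨_, haU, ?_⟩
      rintro _ ⟨m, rfl⟩ _ ⟨n, rfl⟩ hmn
      have h1 : p (a m) = e m := ha m
      have h2 : p (a n) = e n := ha n
      rw [h1, h2] at hmn
      rw [e.injective (Subtype.ext hmn)]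

theorem Ultrafilter.infinite_of_mem_of_le_cofinite {α : Type*} {U : Ultrafilter α}
    (hU : (U : Filter α) ≤ cofinite) {s : Set α} (hs : s ∈ U) : s.Infinite := fun h =>
  Ultrafilter.compl_notMem_iff.2 hs (hU h.compl_mem_cofinite)

/-- A selective ultrafilter contains diagonal intersections thinned out to be homogeneous. -/
theorem IsSelective.exists_mem_forall_lt_mem {U : Ultrafilter ℕ} (hU : IsSelective U)
    (D : ℕ → Set ℕ) (hD : ∀ m, D m ∈ U) : ∃ C ∈ U, ∀ a ∈ C, ∀ b ∈ C, a < b → b ∈ D a := by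
  classical
  -- the first index of a set that misses the point, truncated
  let p : ℕ → ℕ := fun n => Nat.find (p := fun m => n ∉ D m ∨ n ≤ m) ⟨n, .inr le_rfl⟩
  have hp : ∀ n m, m < p n → n ∈ D m := fun n m h => by
    have := Nat.find_min _ h
    tauto
  have hcof : ∀ m, {n | m < n} ∈ U := fun m => by
    refine hU.1 ?_
    rw [mem_cofinite]
    convert Set.finite_Iic m using 1
    ext n
    simp
  -- A point of `D m` above `m` cannot have `m` as its first index, and such points form a set in
  -- `U`.
  have hfib : ∀ m, p ⁻¹' {m} ∉ U := fun m hm => by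
    obtain ⟨n, ⟨hn1, hn2⟩, hn3⟩ :=
      U.nonempty_of_mem (inter_mem (inter_mem hm (hD m)) (hcof m))
    have h := Nat.find_spec (p := fun m => n ∉ D m ∨ n ≤ m) ⟨n, .inr le_rfl⟩
    change n ∉ D (p n) ∨ n ≤ p n at h
    rw [show p n = m from hn1] at h
    rcases h with h | h
    · exact h hn2
    · exact absurd hn3 (not_lt.2 h)
  obtain ⟨B, hB, hpB⟩ := (hU.exists_fiber_mem_or_injOn p).resolve_left fun ⟨m, hm⟩ => hfib m hm
  have hfinB : ∀ m, {n ∈ B | p n ≤ m}.Finite := fun m =>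
    Set.Finite.of_finite_image ((Set.finite_Iic m).subset (by rintro _ ⟨n, hn, rfl⟩; exact hn.2))
      (hpB.mono fun n hn => hn.1)
  choose G hG using fun m => (hfinB m).bddAbove
  have hG' : ∀ m, ∀ n ∈ B, G m < n → n ∈ D m := fun m n hn h => by
    refine hp n m (lt_of_not_ge fun hle => ?_)
    exact absurd (hG m ⟨hn, hle⟩) (not_le.2 h)
  -- a fast growing sequence of bounds
  obtain ⟨q, hq0, hq⟩ : ∃ q : ℕ → ℕ, q 0 = 0 ∧
      ∀ k, q (k + 1) = q k + 1 + ∑ m ∈ Finset.range (q k + 1), G m :=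
    ⟨fun k => Nat.rec 0 (fun _ r => r + 1 + ∑ m ∈ Finset.range (r + 1), G m) k,
      rfl, fun _ => rfl⟩
  have hqmono : StrictMono q := strictMono_nat_of_lt_succ fun k => by rw [hq]; omega
  have hqG : ∀ k m, m ≤ q k → G m < q (k + 1) := fun k m hm => by
    have := Finset.single_le_sum (f := G) (fun _ _ => Nat.zero_le _)
      (Finset.mem_range.2 (Nat.lt_succ_of_le hm))
    rw [hq]
    simp only [Nat.succ_eq_add_one] at this
    omega
  -- The index of the block `[q k, q (k + 1))` containing `n`.
  let s : ℕ → ℕ := fun n => Nat.findGreatest (fun k : ℕ => q k ≤ n) n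
  have hs1 : ∀ n, q (s n) ≤ n := fun n =>
    Nat.findGreatest_spec (P := fun k : ℕ => q k ≤ n) (m := 0) (Nat.zero_le n) (hq0.trans_le (Nat.zero_le n))
  have hs2 : ∀ n, n < q (s n + 1) := fun n => by
    by_contra! h
    have h1 : s n + 1 ≤ n := (hqmono.le_apply).trans h
    have := Nat.le_findGreatest (P := fun k : ℕ => q k ≤ n) h1 h
    change s n + 1 ≤ s n at this
    omega
  have hsmono : ∀ {a b}, a ≤ b → s a ≤ s b := fun {a b} hab => by
    by_contra! h
    have h1 := hqmono.monotone (Nat.succ_le_of_lt h)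
    have h2 := hs1 a
    have h3 := hs2 b
    simp only [Nat.succ_eq_add_one] at h1
    omega
  have hsfib : ∀ m, s ⁻¹' {m} ∉ U := fun m hm => by
    obtain ⟨n, hn1, hn2⟩ := U.nonempty_of_mem (inter_mem hm (hcof (q (m + 1))))
    have := hs2 n
    rw [show s n = m from hn1] at this
    exact absurd hn2 (not_lt.2 this.le)
  obtain ⟨C, hC, hsC⟩ := (hU.exists_fiber_mem_or_injOn s).resolve_left fun ⟨m, hm⟩ => hsfib m hm
  -- Fixing the parity of the block leaves a whole block between any two chosen points, enough to
  -- jump past the bound `G a`.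
  obtain ⟨r, hr⟩ : ∃ r, {n | s n % 2 = r} ∈ U := by
    rcases Ultrafilter.em U (fun n => s n % 2 = 0) with h | h
    · exact ⟨0, h⟩
    · exact ⟨1, mem_of_superset h fun n (hn : ¬ s n % 2 = 0) => by
        change s n % 2 = 1
        omega⟩
  refine ⟨B ∩ C ∩ {n | s n % 2 = r}, inter_mem (inter_mem hB hC) hr, ?_⟩
  rintro a ⟨⟨-, haC⟩, har⟩ b ⟨⟨hbB, hbC⟩, hbr⟩ hab
  refine hG' a b hbB ?_
  have h1 : s a ≠ s b := fun h => hab.ne (hsC haC hbC h)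
  have h2 := hsmono hab.le
  have h3 : s a + 2 ≤ s b := by
    change s a % 2 = r at har
    change s b % 2 = r at hbr
    omega
  calc G a < q (s a + 1 + 1) := hqG _ _ (hs2 a).le
    _ ≤ q (s b) := hqmono.monotone h3
    _ ≤ b := hs1 b

end Selective

/-! ### Construction of a character with prescribed `U`-limits. -/

section Construction

theorem eventually_forall_finset_exists_norm_linearCombination_sub_lt {X N ι : Type*}
    {l : Filter N} (v : ι → N → X →₀ ℤ)
    (h : ∀ c : ι →₀ ℤ, c ≠ 0 → ∀ᶠ n in l, (c.sum fun i k => k • v i n) ≠ 0)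
    (T : Finset ι) {ε : ℝ} (hε : 0 < ε) :
    ∀ᶠ n in l, ∀ y : ι → UnitAddCircle, ∃ x : X → UnitAddCircle,
      ∀ i ∈ T, ‖Finsupp.linearCombination ℤ x (v i n) - y i‖ < ε := by
  classical
  have := eventually_forall_exists_norm_linearCombination_sub_lt (l := l)
    (fun i : T => v i) (fun c hc => ?_) hε
  · filter_upwards [this] with n hn y
    obtain ⟨x, hx⟩ := hn fun i => y i
    exact ⟨x, fun i hi => hx ⟨i, hi⟩⟩
  · let c' : T →₀ ℤ := Finsupp.equivFunOnFinite.symm c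
    have hc' : c'.embDomain (Function.Embedding.subtype _) ≠ 0 := by
      rw [Ne, Finsupp.embDomain_eq_zero]
      intro h0
      refine hc (funext fun i => ?_)
      exact DFunLike.congr_fun h0 i
    filter_upwards [h _ hc'] with n hn
    rwa [Finsupp.sum_embDomain,
      Finsupp.sum_fintype c' _ (fun i => zero_smul ℤ (v i n))] at hn

/-- The `ℓ¹` norm of a finitely supported integer function. -/
noncomputable def absSum {X : Type*} (g : X →₀ ℤ) : ℝ := ∑ e ∈ g.support, |(g e : ℝ)|

theorem absSum_nonneg {X : Type*} (g : X →₀ ℤ) : 0 ≤ absSum g :=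
  Finset.sum_nonneg fun _ _ => abs_nonneg _

theorem dist_linearCombination_le {X : Type*} (g : X →₀ ℤ) {x y : X → UnitAddCircle} {δ : ℝ}
    (h : ∀ e ∈ g.support, dist (x e) (y e) ≤ δ) :
    dist (Finsupp.linearCombination ℤ x g) (Finsupp.linearCombination ℤ y g) ≤ absSum g * δ := by
  simp only [Finsupp.linearCombination_apply, Finsupp.sum, absSum, Finset.sum_mul]
  refine dist_sum_sum_le_of_le _ fun e he => ?_
  rw [dist_eq_norm, ← smul_sub]
  refine (norm_zsmul_le _ _).trans ?_
  rw [Int.norm_eq_abs, ← dist_eq_norm]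
  exact mul_le_mul_of_nonneg_left (h e he) (abs_nonneg _)

/-- Points of the torus can be found that agree with a given one up to `ε` in finitely many
coordinates while the given integer vectors take prescribed values up to `ε`. -/
def ApproxSolvable {X : Type*} {I : X → Prop} (f : {x // I x} → X →₀ ℤ) (E : Finset X) (ε : ℝ) :
    Prop :=
  ∀ (z : X → UnitAddCircle) (t : {x // I x} → UnitAddCircle), ∃ x : X → UnitAddCircle,
    (∀ e ∈ E, dist (x e) (z e) < ε) ∧
      ∀ ξ : {x // I x}, ξ.1 ∈ E → dist (Finsupp.linearCombination ℤ x (f ξ)) (t ξ) < ε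

/-- Staying near `z` on `E` is itself a prescription of values, at the unit vectors `Finsupp.single
e 1`; adding these to the family reduces the claim to Kronecker approximation. -/
theorem eventually_approxSolvable {X N : Type*} {I : X → Prop} {l : Filter N}
    (f : {x // I x} → N → X →₀ ℤ)
    (h : ∀ c : ({x // I x} ⊕ X) →₀ ℤ, c ≠ 0 → ∀ᶠ n in l,
      (c.sum fun i k => k • Sum.elim (fun ξ => f ξ n) (fun e => Finsupp.single e 1) i) ≠ 0)
    (E : Finset X) {ε : ℝ} (hε : 0 < ε) : ∀ᶠ n in l, ApproxSolvable (fun ξ => f ξ n) E ε := by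
  classical
  filter_upwards [eventually_forall_finset_exists_norm_linearCombination_sub_lt
    (fun i n => Sum.elim (fun ξ => f ξ n) (fun e => Finsupp.single e 1) i) h
    ((E.subtype I).disjSum E) hε] with n hn z t
  obtain ⟨x, hx⟩ := hn (Sum.elim t z)
  refine ⟨x, fun e he => ?_, fun ξ hξ => ?_⟩
  · simpa [dist_eq_norm] using hx (.inr e) (by simpa using he)
  · simpa [dist_eq_norm] using hx (.inl ξ) (by simpa using hξ)

/-- Finite subsets exhausting a set that contains `E₀` and the supports of `f ξ n` for its
members `ξ`. -/
noncomputable def supportClosure {X : Type*} {I : X → Prop} (f : {x // I x} → ℕ → X →₀ ℤ)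
    (E₀ : Finset X) : ℕ → Finset X
  | 0 => E₀
  | m + 1 => by
    classical
    exact supportClosure f E₀ m ∪ ((supportClosure f E₀ m).subtype I).biUnion fun ξ =>
      (Finset.range (m + 1)).biUnion fun j => (f ξ j).support

theorem supportClosure_mono {X : Type*} {I : X → Prop} (f : {x // I x} → ℕ → X →₀ ℤ)
    (E₀ : Finset X) : Monotone (supportClosure f E₀) :=
  monotone_nat_of_le_succ fun m => by
    classical
    rw [supportClosure]
    exact Finset.subset_union_left

theorem support_subset_supportClosure {X : Type*} {I : X → Prop} (f : {x // I x} → ℕ → X →₀ ℤ)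
    (E₀ : Finset X) {m j : ℕ} (hj : j ≤ m) {ξ : {x // I x}} (hξ : ξ.1 ∈ supportClosure f E₀ m) :
    (f ξ j).support ⊆ supportClosure f E₀ (m + 1) := by
  classical
  rw [supportClosure]
  refine Finset.Subset.trans ?_ Finset.subset_union_right
  intro e he
  simp only [Finset.mem_biUnion, Finset.mem_subtype, Finset.mem_range]
  exact ⟨ξ, hξ, j, Nat.lt_succ_of_le hj, he⟩

/-- The last condition ensures that moving coordinates by `ε (m + 1)` changes the value at `f ξ m`
by at most `ε m`. Halving makes the total of all later corrections summable. -/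
theorem exists_precision {X : Type*} {I : X → Prop} (f : {x // I x} → ℕ → X →₀ ℤ)
    (E : ℕ → Finset X) {ε₀ : ℝ} (h₀ : 0 < ε₀) :
    ∃ ε : ℕ → ℝ, ε 0 = ε₀ ∧ (∀ m, 0 < ε m) ∧ (∀ m, ε (m + 1) ≤ ε m / 2) ∧
      ∀ m (ξ : {x // I x}), ξ.1 ∈ E m → absSum (f ξ m) * ε (m + 1) ≤ ε m := by
  classical
  let S : ℕ → ℝ := fun m => ∑ ξ ∈ (E m).subtype I, absSum (f ξ m)
  have hS : ∀ m, 0 ≤ S m := fun m => Finset.sum_nonneg fun _ _ => absSum_nonneg _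
  obtain ⟨ε, hε0, hε⟩ : ∃ ε : ℕ → ℝ, ε 0 = ε₀ ∧ ∀ m, ε (m + 1) = ε m / (2 + S m) :=
    ⟨fun k => Nat.rec ε₀ (fun m r => r / (2 + S m)) k, rfl, fun _ => rfl⟩
  have hpos : ∀ m, 0 < ε m := fun m => by
    induction m with
    | zero => rwa [hε0]
    | succ m ih =>
      rw [hε]
      have := hS m
      positivity
  refine ⟨ε, hε0, hpos, fun m => ?_, fun m ξ hξ => ?_⟩
  · rw [hε]
    exact div_le_div_of_nonneg_left (hpos m).le two_pos (by linarith [hS m])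
  · have h1 : absSum (f ξ m) ≤ S m :=
      Finset.single_le_sum (f := fun ξ => absSum (f ξ m)) (fun _ _ => absSum_nonneg _)
        (by simpa using hξ)
    have h2 := hS m
    rw [hε, mul_div_assoc', div_le_iff₀ (by linarith), mul_comm]
    exact mul_le_mul_of_nonneg_left (by linarith) (hpos m).le

theorem exists_near_limits {X : Type*} (F : ℕ → Finset X) (hF : Monotone F) (η : ℕ → ℝ)
    (hη : ∀ k, η (k + 1) ≤ η k / 2) (x : ℕ → X → UnitAddCircle)
    (hx : ∀ k, ∀ e ∈ F k, dist (x (k + 1) e) (x k e) ≤ η k / 2) :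
    ∃ y : X → UnitAddCircle, ∀ k, ∀ e ∈ F k, dist (x k e) (y e) ≤ η k := by
  have hgeo : ∀ k j, η (k + j) ≤ η k / 2 ^ j := fun k j => by
    induction j with
    | zero => simp
    | succ j ih =>
      calc η (k + (j + 1)) ≤ η (k + j) / 2 := hη _
        _ ≤ η k / 2 ^ j / 2 := by linarith
        _ = η k / 2 ^ (j + 1) := by rw [pow_succ, div_div]
  have hstep : ∀ k, ∀ e ∈ F k, ∀ j, dist (x (k + j) e) (x (k + (j + 1)) e) ≤ η k / 2 / 2 ^ j :=
    fun k e he j => by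
      rw [dist_comm]
      refine (hx (k + j) e (hF (Nat.le_add_right _ _) he)).trans ?_
      have := hgeo k j
      rw [div_right_comm]
      linarith
  have hlim : ∀ e, ∃ a, ∀ k, e ∈ F k → dist (x k e) a ≤ η k := fun e => by
    by_cases he : ∃ k, e ∈ F k
    · obtain ⟨k, hk⟩ := he
      obtain ⟨a, ha⟩ := cauchySeq_tendsto_of_complete
        (cauchySeq_of_le_geometric_two (f := fun j => x (k + j) e) (hstep k e hk))
      have ha' : Tendsto (fun j => x j e) atTop (𝓝 a) := by
        refine (tendsto_add_atTop_iff_nat (f := fun j => x j e) k).1 ?_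
        simpa only [add_comm] using ha
      refine ⟨a, fun i hi => ?_⟩
      refine dist_le_of_le_geometric_two_of_tendsto₀ (f := fun j => x (i + j) e)
        (hstep i e hi) ?_
      simpa only [add_comm] using (tendsto_add_atTop_iff_nat (f := fun j => x j e) i).2 ha'
    · exact ⟨0, fun k hk => absurd ⟨k, hk⟩ he⟩
  choose y hy using hlim
  exact ⟨y, fun k e he => hy e k he⟩

/-- On some set closed under the supports of the sequences, there is a point of the torus at which
a given nonzero vector does not vanish and all sequences converge as desired. -/
theorem IsSelective.exists_tendsto_linearCombination_on {U : Ultrafilter ℕ} (hU : IsSelective U)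
    {X : Type*} {I : X → Prop} (f : {x // I x} → ℕ → X →₀ ℤ)
    (hf : ∀ (E : Finset X) (ε : ℝ), 0 < ε →
      ∀ᶠ n in (U : Filter ℕ), ApproxSolvable (fun ξ => f ξ n) E ε) {J : X →₀ ℤ} (hJ : J ≠ 0) :
    ∃ (E : Set X) (x : X → UnitAddCircle), (∀ e ∈ J.support, e ∈ E) ∧
      (∀ ξ : {x // I x}, ξ.1 ∈ E → ∀ n, ∀ e ∈ (f ξ n).support, e ∈ E) ∧
      Finsupp.linearCombination ℤ x J ≠ 0 ∧
      ∀ ξ : {x // I x}, ξ.1 ∈ E →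
        Tendsto (fun n => Finsupp.linearCombination ℤ x (f ξ n)) U (𝓝 (x ξ)) := by
  let E := supportClosure f J.support
  have hE : Monotone E := supportClosure_mono f _
  have hJ' := absSum_nonneg J
  -- Moving coordinates by `ε 0` changes the value at `J` by less than `1 / 4`, while the initial
  -- value is `1 / 2`.
  obtain ⟨ε, hε0, hεpos, hεhalf, hεf⟩ :=
    exists_precision f E (ε₀ := 1 / (4 * (1 + absSum J))) (by positivity)
  have hεanti : Antitone ε := antitone_nat_of_succ_le fun m => by
    linarith [hεhalf m, hεpos m]
  obtain ⟨C, hC, hCD⟩ := hU.exists_mem_forall_lt_mem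
    (fun m => {n | ApproxSolvable (fun ξ => f ξ n) (E (m + 1)) (ε (m + 1) / 2)})
    fun m => hf _ _ (half_pos (hεpos _))
  have hCinf : {n | n ∈ C}.Infinite := Ultrafilter.infinite_of_mem_of_le_cofinite hU.1 hC
  let N : ℕ → ℕ := Nat.nth (· ∈ C)
  have hN : StrictMono N := Nat.nth_strictMono hCinf
  have hNC : ∀ k, N k ∈ C := Nat.nth_mem_of_infinite hCinf
  obtain ⟨x₀, hx₀⟩ := exists_linearCombination_eq_half hJ
  -- Homogeneity of `C` makes `N (k + 1)` solvable for the finite set and precision fixed at stage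
  -- `N k`. The target at `ξ` is the current value `z ξ` itself.
  have hsolve : ∀ k (z : X → UnitAddCircle), ∃ x : X → UnitAddCircle,
      (∀ e ∈ E (N k + 1), dist (x e) (z e) < ε (N k + 1) / 2) ∧
        ∀ ξ : {x // I x}, ξ.1 ∈ E (N k + 1) →
          dist (Finsupp.linearCombination ℤ x (f ξ (N (k + 1)))) (z ξ) < ε (N k + 1) / 2 :=
    fun k z => hCD (N k) (hNC k) (N (k + 1)) (hNC (k + 1)) (hN k.lt_succ_self) z fun ξ => z ξ
  choose s hs using hsolve
  obtain ⟨x, hx0, hx⟩ : ∃ x : ℕ → X → UnitAddCircle, x 0 = x₀ ∧ ∀ k, x (k + 1) = s k (x k) :=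
    ⟨fun k => Nat.rec x₀ s k, rfl, fun _ => rfl⟩
  obtain ⟨y, hy⟩ := exists_near_limits (fun k => E (N k + 1))
    (fun i j hij => hE (Nat.succ_le_succ (hN.monotone hij))) (fun k => ε (N k + 1))
    (fun k => (hεhalf (N (k + 1))).trans
      (div_le_div_of_nonneg_right (hεanti (hN k.lt_succ_self)) two_pos.le)) x
    (fun k e he => by rw [hx]; exact ((hs k (x k)).1 e he).le)
  refine ⟨{e | ∃ m, e ∈ E m}, y, fun e he => ⟨0, he⟩, ?_, ?_, ?_⟩
  · rintro ξ ⟨m, hm⟩ n e he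
    exact ⟨max m n + 1, support_subset_supportClosure f _ (le_max_right m n)
      (hE (le_max_left m n) hm) he⟩
  · intro h0
    have h1 : dist (Finsupp.linearCombination ℤ x₀ J) (Finsupp.linearCombination ℤ y J)
        ≤ absSum J * ε 0 := dist_linearCombination_le J fun e he => by
      have := hy 0 e (hE (Nat.zero_le _) he)
      rw [hx0] at this
      exact this.trans (hεanti (Nat.zero_le _))
    rw [h0, hx₀, dist_zero_right, norm_coe_half, hε0, mul_one_div, div_le_div_iff₀ two_pos
      (by positivity)] at h1
    linarith
  · rintro ξ ⟨m, hm⟩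
    -- Three errors add up: from `y` to `x (j + 1)` on the support of `f ξ (N (j + 1))`, the
    -- approximate solution itself, and from `x j ξ` to `y ξ`.
    have hclose : ∀ j, m ≤ j →
        dist (Finsupp.linearCombination ℤ y (f ξ (N (j + 1)))) (y ξ) ≤ 3 * ε j := fun j hj => by
      have hjN : j ≤ N j := hN.le_apply
      have hξ : ξ.1 ∈ E (N j + 1) := hE (by omega) hm
      have hξ' : ξ.1 ∈ E (N (j + 1)) := hE (hN j.lt_succ_self) hξ
      have h1 : dist (Finsupp.linearCombination ℤ (x (j + 1)) (f ξ (N (j + 1))))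
          (Finsupp.linearCombination ℤ y (f ξ (N (j + 1)))) ≤ ε (N (j + 1)) :=
        (dist_linearCombination_le _ fun e he => hy (j + 1) e
          (support_subset_supportClosure f _ le_rfl hξ' he)).trans (hεf _ ξ hξ')
      have h2 := (hs j (x j)).2 ξ hξ
      rw [← hx] at h2
      have h3 := hy j ξ hξ
      have h4 : ε (N j + 1) ≤ ε j := hεanti (by omega)
      have h5 : ε (N (j + 1)) ≤ ε (N j + 1) := hεanti (hN j.lt_succ_self)
      have h6 := dist_triangle4 (Finsupp.linearCombination ℤ y (f ξ (N (j + 1))))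
        (Finsupp.linearCombination ℤ (x (j + 1)) (f ξ (N (j + 1)))) (x j ξ) (y ξ)
      rw [dist_comm] at h1
      linarith [hεpos (N j + 1)]
    have hε_lim : Tendsto ε atTop (𝓝 0) := by
      have hgeo : ∀ m, ε m ≤ ε 0 * (1 / 2) ^ m := fun m => by
        induction m with
        | zero => simp
        | succ m ih =>
          rw [pow_succ]
          linarith [hεhalf m]
      refine squeeze_zero (fun m => (hεpos m).le) hgeo ?_
      simpa using (tendsto_pow_atTop_nhds_zero_of_lt_one (r := (1 / 2 : ℝ)) (by norm_num)
        (by norm_num)).const_mul (ε 0)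
    rw [Metric.tendsto_nhds]
    intro δ hδ
    obtain ⟨j₀, hj₀m, hj₀⟩ := ((eventually_ge_atTop m).and
      (hε_lim.eventually (gt_mem_nhds (show 0 < δ / 3 by positivity)))).exists
    have hlarge : ∀ᶠ n in (U : Filter ℕ), N j₀ < n := by
      refine hU.1 ?_
      rw [Nat.cofinite_eq_atTop]
      exact eventually_gt_atTop _
    filter_upwards [hC, hlarge] with n hnC hn
    obtain ⟨i, rfl⟩ : n ∈ Set.range N := by
      rw [Nat.range_nth_of_infinite hCinf]
      exact hnC
    have hi : j₀ < i := hN.lt_iff_lt.1 hn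
    -- The point `N 0` carries no approximation, so the index has to be a successor.
    obtain ⟨j, rfl⟩ := Nat.exists_eq_succ_of_ne_zero (Nat.ne_zero_of_lt hi)
    have hjj : j₀ ≤ j := Nat.lt_succ_iff.1 hi
    have := hclose j (hj₀m.trans hjj)
    have := hεanti hjj
    simp only [Nat.succ_eq_add_one]
    linarith

/-- A partial solution on a closed set extends to the whole well-ordered index set by recursion. -/
theorem exists_tendsto_linearCombination_extension {N X : Type*} [LinearOrder X]
    [WellFoundedLT X] (U : Ultrafilter N) {I : X → Prop} (f : {x // I x} → N → X →₀ ℤ)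
    (hf : ∀ ξ n, ∀ β ∈ (f ξ n).support, β < ξ.1) (E : Set X) (x : X → UnitAddCircle)
    (hE : ∀ ξ : {x // I x}, ξ.1 ∈ E → ∀ n, ∀ e ∈ (f ξ n).support, e ∈ E)
    (hx : ∀ ξ : {x // I x}, ξ.1 ∈ E →
      Tendsto (fun n => Finsupp.linearCombination ℤ x (f ξ n)) U (𝓝 (x ξ))) :
    ∃ y : X → UnitAddCircle, (∀ e ∈ E, y e = x e) ∧ ∀ ξ : {x // I x},
      Tendsto (fun n => Finsupp.linearCombination ℤ y (f ξ n)) U (𝓝 (y ξ)) := by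
  classical
  -- The inner default `0` is never reached, as supports lie below `ξ`; the outer one serves indices
  -- outside `E` that carry no sequence.
  let step : ∀ ξ : X, (∀ β, β < ξ → UnitAddCircle) → UnitAddCircle := fun ξ r =>
    if ξ ∈ E then x ξ else if h : I ξ then
      (U.map fun n => (f ⟨ξ, h⟩ n).sum fun β k => k • if hβ : β < ξ then r β hβ else 0).lim
    else 0
  let y : X → UnitAddCircle := wellFounded_lt.fix step
  have hy : ∀ ξ, y ξ = step ξ fun β _ => y β := fun ξ => wellFounded_lt.fix_eq step ξ
  have hyE : ∀ e ∈ E, y e = x e := fun e he => by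
    rw [hy]
    exact if_pos he
  refine ⟨y, hyE, fun ξ => ?_⟩
  by_cases hξ : ξ.1 ∈ E
  · rw [hyE _ hξ]
    convert hx ξ hξ using 2 with n
    simp only [Finsupp.linearCombination_apply]
    exact Finsupp.sum_congr fun e he => by rw [hyE e (hE ξ hξ n e he)]
  · have h1 : y ξ = (U.map fun n => Finsupp.linearCombination ℤ y (f ξ n)).lim := by
      rw [hy]
      simp only [step, if_neg hξ, dif_pos ξ.2]
      congr 2
      ext n
      rw [Finsupp.linearCombination_apply]
      exact Finsupp.sum_congr fun e he => by rw [dif_pos (hf ξ n e he)]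
    rw [h1]
    exact Ultrafilter.le_nhds_lim _

end Construction

/-! ### Enumerating the injective sequences. -/

section Enumeration

open Cardinal

theorem mk_contIdx : #ContIdx = 𝔠 := mk_ord_toType _

theorem mk_Iio_contIdx_lt (ξ : ContIdx) : #(Set.Iio ξ) < 𝔠 := by
  simpa [mk_contIdx] using mk_Iio_lt ξ (by simp)

theorem mk_freeAbCont : #FreeAbCont = 𝔠 := by
  have : Infinite ContIdx := infinite_iff.2 (by rw [mk_contIdx]; exact aleph0_le_continuum)
  rw [mk_finsupp_of_infinite, mk_contIdx, mk_int, max_eq_left aleph0_le_continuum]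

theorem aleph0_lt_cof_contIdx : ℵ₀ < Order.cof ContIdx := by
  rw [Ordinal.cof_toType]
  exact lt_cof_ord_power le_rfl one_lt_two

/-- The union of the supports is countable, hence not cofinal in `𝔠`. -/
theorem exists_forall_support_lt (f : ℕ → FreeAbCont) :
    ∃ ξ : ContIdx, ∀ n, ∀ β ∈ (f n).support, β < ξ := by
  have h : ¬ IsCofinal (⋃ n, ((f n).support : Set ContIdx)) := fun h => by
    have h1 := (Order.cof_le h).trans
      (Set.countable_iUnion fun n => (f n).support.countable_toSet).le_aleph0
    exact absurd aleph0_lt_cof_contIdx (not_lt.2 h1)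
  simp only [IsCofinal, not_forall, not_exists, not_and, not_le] at h
  obtain ⟨ξ, hξ⟩ := h
  exact ⟨ξ, fun n β hβ => hξ β (Set.mem_iUnion.2 ⟨n, hβ⟩)⟩

theorem exists_injective_seq_support_lt (ξ : ContIdxPos) :
    ∃ f : ℕ → FreeAbCont, Function.Injective f ∧ ∀ n, ∀ β ∈ (f n).support, β < ξ.1 := by
  obtain ⟨b, hb⟩ := not_isMin_iff.1 ξ.2
  refine ⟨fun n => Finsupp.single b (n : ℤ), fun m n hmn => ?_, fun n β hβ => ?_⟩
  · exact_mod_cast Finsupp.single_injective b hmn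
  · rw [Finset.mem_singleton.1 (Finsupp.support_single_subset hβ)]
    exact hb

theorem exists_isInjSeqEnumeration : ∃ h, IsInjSeqEnumeration h := by
  classical
  have hle : #({f : ℕ → FreeAbCont // Function.Injective f} × ContIdx) ≤ #ContIdx := by
    rw [mk_prod, lift_id, lift_id, mk_contIdx]
    have h1 : #{f : ℕ → FreeAbCont // Function.Injective f} ≤ 𝔠 := by
      refine (mk_subtype_le _).trans ?_
      rw [← power_def, mk_freeAbCont, mk_nat, continuum_power_aleph0]
    exact (mul_le_mul_left h1 𝔠).trans (continuum_mul_self).le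
  obtain ⟨e⟩ := hle
  have : Nonempty ContIdx := mk_ne_zero_iff.1 (by rw [mk_contIdx]; exact continuum_ne_zero)
  obtain ⟨b⟩ := this
  let f₀ : {f : ℕ → FreeAbCont // Function.Injective f} :=
    ⟨fun n => Finsupp.single b (n : ℤ), fun m n hmn => by
      exact_mod_cast Finsupp.single_injective b hmn⟩
  have : Nonempty ({f : ℕ → FreeAbCont // Function.Injective f} × ContIdx) := ⟨(f₀, b)⟩
  -- The factor `ContIdx` makes `G` list each sequence `𝔠` times, hence beyond any bound on its
  -- supports. Positions where the listed sequence does not fit get the filler `d ξ`.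
  let G := Function.invFun e
  have hG : Function.Surjective G := Function.invFun_surjective e.injective
  choose d hdinj hdsupp using exists_injective_seq_support_lt
  refine ⟨fun ξ => if ∀ n, ∀ β ∈ ((G ξ.1).1.1 n).support, β < ξ.1 then (G ξ.1).1.1 else d ξ,
    ?_, fun ξ n β hβ => ?_⟩
  · refine Set.Subset.antisymm ?_ fun f hf => ?_
    · rintro _ ⟨ξ, rfl⟩
      simp only [Set.mem_ofPred_eq]
      split_ifs
      · exact (G ξ.1).1.2
      · exact hdinj ξ
    · obtain ⟨β, hβ⟩ := exists_forall_support_lt f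
      obtain ⟨ξ, hξ, hξf⟩ : ∃ ξ, β ≤ ξ ∧ (G ξ).1 = ⟨f, hf⟩ := by
        by_contra! hcon
        choose s hs using fun α : ContIdx => hG (⟨f, hf⟩, α)
        have hsβ : ∀ α, s α ∈ Set.Iio β := fun α => by
          by_contra h
          exact hcon (s α) (not_lt.1 h) (by rw [hs])
        have hsinj : Function.Injective fun α => (⟨s α, hsβ α⟩ : Set.Iio β) := fun α γ h => by
          have := hs α
          rw [Subtype.mk_eq_mk.1 h, hs] at this
          exact (congrArg Prod.snd this).symm
        have h1 := mk_le_of_injective hsinj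
        rw [mk_contIdx] at h1
        exact absurd (mk_Iio_contIdx_lt β) (not_lt.2 h1)
      have hξmin : ¬ IsMin ξ := by
        obtain ⟨n, hn⟩ : ∃ n, f n ≠ 0 := by
          by_contra! h0
          exact zero_ne_one (hf ((h0 0).trans (h0 1).symm))
        obtain ⟨α, hα⟩ := Finsupp.support_nonempty_iff.2 hn
        exact not_isMin_iff.2 ⟨α, (hβ n α hα).trans_le hξ⟩
      refine ⟨⟨ξ, hξmin⟩, ?_⟩
      simp only [hξf]
      exact if_pos fun n α hα => (hβ n α hα).trans_le hξ
  · simp only at hβ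
    split_ifs at hβ with h
    · exact h n β hβ
    · exact hdsupp ξ n β hβ

end Enumeration

/-! ### Permutations making the family independent. -/

section Independence

open Cardinal

theorem exists_wellFounded_choice {α β : Type*} [LT α] [WellFoundedLT α]
    (P : ∀ a : α, (∀ b, b < a → β) → β → Prop) (h : ∀ a r, ∃ x, P a r x) :
    ∃ f : α → β, ∀ a, P a (fun b _ => f b) (f a) := by
  choose s hs using h
  refine ⟨wellFounded_lt.fix s, fun a => ?_⟩
  rw [WellFounded.fix_eq]
  exact hs _ _

/-- There are continuum many permutations of `ℕ` any two of which agree at finitely many points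
only. -/
theorem exists_perm_family_almost_disjoint :
    ∃ s : (ℕ → Bool) → Equiv.Perm ℕ, ∀ r r', r ≠ r' → {n | s r n = s r' n}.Finite := by
  obtain ⟨e⟩ : Nonempty (ℕ ≃ Σ k, (Fin k → Bool)) := nonempty_equiv_of_countable
  -- On level `k` of the binary tree, `r` acts by adding its first `k` bits. Two branches that
  -- differ at `i` act differently at every node of level above `i`.
  let t : (ℕ → Bool) → Equiv.Perm (Σ k, (Fin k → Bool)) := fun r =>
    Equiv.sigmaCongrRight fun k => Function.Involutive.toPerm
      (fun v i => Bool.xor (v i) (r i)) fun v => by ext i; simp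
  refine ⟨fun r => (e.trans (t r)).trans e.symm, fun r r' hrr => ?_⟩
  obtain ⟨i, hi⟩ := Function.ne_iff.1 hrr
  have hfin : (⋃ k ∈ Set.Iic i,
      Set.range fun v : Fin k → Bool => (⟨k, v⟩ : Σ k, (Fin k → Bool))).Finite :=
    (Set.finite_Iic i).biUnion fun k _ => Set.finite_range _
  refine (hfin.preimage e.injective.injOn).subset fun n hn => ?_
  have hn' : t r (e n) = t r' (e n) := e.symm.injective hn
  rw [Set.mem_preimage]
  generalize e n = p at hn' ⊢
  obtain ⟨k, v⟩ := p
  refine Set.mem_iUnion₂.2 ⟨k, Set.mem_Iic.2 (not_lt.1 fun hk => hi ?_), v, rfl⟩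
  have h1 := congrFun (eq_of_heq (Sigma.mk.inj_iff.1 hn').2) ⟨i, hk⟩
  exact Bool.xor_right_inj.1 h1

variable {U : Ultrafilter ℕ}

/-- The class of a sequence in the ultrapower, as a linear map. -/
noncomputable def germLinearMap (U : Ultrafilter ℕ) :
    (ℕ → ContIdx →₀ ℚ) →ₗ[ℚ] (U : Filter ℕ).Germ (ContIdx →₀ ℚ) where
  toFun f := f
  map_add' _ _ := rfl
  map_smul' _ _ := rfl

/-- Restriction of functions to the indices below `ξ`, on the ultrapower. -/
noncomputable def truncGerm (U : Ultrafilter ℕ) (ξ : ContIdx) :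
    (U : Filter ℕ).Germ (ContIdx →₀ ℚ) →ₗ[ℚ] (U : Filter ℕ).Germ (ContIdx →₀ ℚ) where
  toFun := Germ.map (Finsupp.filter (· < ξ))
  map_add' a b := by
    induction a, b using Germ.inductionOn₂ with
    | h f g =>
      simp only [← Germ.coe_add, Germ.map_coe]
      congr 1
      ext1 n
      simp [Finsupp.filter_add]
  map_smul' c a := by
    induction a using Germ.inductionOn with
    | h f =>
      simp only [← Germ.coe_smul, Germ.map_coe]
      congr 1
      ext1 n
      simp [Finsupp.filter_smul]

theorem truncGerm_ultraClass (ξ : ContIdx) (f : ℕ → FreeAbCont) :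
    truncGerm U ξ (ultraClass U f) = ultraClass U fun n => (f n).filter (· < ξ) := by
  rw [ultraClass, ultraClass]
  change Germ.map (Finsupp.filter (· < ξ)) (Germ.ofFun _) = _
  rw [Germ.map_coe]
  congr 1
  ext n β
  by_cases h : β < ξ <;> simp [h]

theorem ultraClass_eq_iff {f g : ℕ → FreeAbCont} :
    ultraClass U f = ultraClass U g ↔ ∀ᶠ n in (U : Filter ℕ), f n = g n := by
  rw [ultraClass, ultraClass, Germ.coe_eq]
  have hinj := Finsupp.mapRange_injective (α := ContIdx) (Int.cast : ℤ → ℚ) Int.cast_zero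
    Int.cast_injective
  exact ⟨fun h => h.mono fun n hn => hinj hn, fun h => h.mono fun n hn => congrArg _ hn⟩

theorem ultraClass_zero : ultraClass U (fun _ => 0) = 0 := by
  rw [ultraClass]
  simp only [Finsupp.mapRange_zero]
  rfl

theorem linearCombination_ultraClass {ι : Type*} (v : ι → ℕ → FreeAbCont) (c : ι →₀ ℤ) :
    Finsupp.linearCombination ℤ (fun i => ultraClass U (v i)) c =
      ultraClass U fun n => c.sum fun i k => k • v i n := by
  let A : (ℕ → FreeAbCont) →+ (U : Filter ℕ).Germ (ContIdx →₀ ℚ) :=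
    { toFun := ultraClass U
      map_zero' := ultraClass_zero
      map_add' f g := by
        rw [ultraClass, ultraClass, ultraClass, ← Germ.coe_add]
        refine congrArg Germ.ofFun (funext fun n => ?_)
        ext β
        simp }
  have h := map_finsuppSum A c fun i k => k • v i
  simp only [map_zsmul] at h
  rw [Finsupp.linearCombination_apply]
  refine h.symm.trans ?_
  change ultraClass U _ = _
  refine congrArg _ (funext fun n => ?_)
  simp [Finsupp.sum]

/-- Transfers independence in the ultrapower to the coordinates: a relation holding on a set in `U`
would hold between the classes. -/
theorem IsIndependentFamily.eventually_sum_ne_zero {h : ContIdxPos → ℕ → FreeAbCont}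
    {σ : ContIdxPos → Equiv.Perm ℕ} (hσ : IsIndependentFamily U h σ)
    (c : (ContIdxPos ⊕ ContIdx) →₀ ℤ) (hc : c ≠ 0) : ∀ᶠ n in (U : Filter ℕ),
      (c.sum fun i k =>
        k • Sum.elim (fun ξ => h ξ (σ ξ n)) (fun e => Finsupp.single e (1 : ℤ)) i) ≠ 0 := by
  rw [Ultrafilter.eventually_not]
  intro h0
  have hσ' := hσ.restrict_scalars (R := ℤ) (fun a b hab => by simpa using hab)
  refine hc (linearIndependent_iff.1 hσ' c ?_)
  have hv : (Sum.elim (fun ξ : ContIdxPos => ultraClass U (h ξ ∘ σ ξ))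
      (fun β : ContIdx => ultraClass U (fun _ => chi β))) = fun i => ultraClass U
        fun n => Sum.elim (fun ξ => h ξ (σ ξ n)) (fun e => Finsupp.single e (1 : ℤ)) i := by
    ext1 i
    cases i <;> rfl
  rw [hv, linearCombination_ultraClass, ← ultraClass_zero, ultraClass_eq_iff]
  exact h0

/-- A combination of these classes is the class of a constant sequence, which vanishes only if the
constant does. -/
theorem linearIndependent_ultraClass_chi :
    LinearIndependent ℚ fun β : ContIdx => ultraClass U fun _ => chi β := by
  rw [linearIndependent_iff]
  intro c hc
  have h1 : ∀ c : ContIdx →₀ ℚ, Finsupp.linearCombination ℚ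
      (fun β : ContIdx => ultraClass U fun _ => chi β) c = germLinearMap U fun _ => c := by
    intro c
    induction c using Finsupp.induction_linear with
    | zero => simp; exact (map_zero (germLinearMap U)).symm
    | add a b ha hb =>
      rw [map_add, ha, hb, ← map_add]
      rfl
    | single β a =>
      rw [Finsupp.linearCombination_single]
      change _ = germLinearMap U fun _ => _
      rw [show (fun _ : ℕ => Finsupp.single β a) = a • fun _ : ℕ => Finsupp.single β (1 : ℚ) by
        ext1; simp, map_smul]
      refine congrArg (a • ·) (congrArg Germ.ofFun (funext fun n => ?_))
      simp [chi]
  rw [h1] at hc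
  have h2 : ∀ᶠ n in (U : Filter ℕ), c = 0 := Germ.coe_eq.1 hc
  exact h2.exists.choose_spec

/-- A family indexed by a well-order, together with an independent one, is independent if no member
is in the span of its predecessors and the independent family. -/
theorem linearIndependent_sumElim_of_notMem_span {K M α κ : Type*} [DivisionRing K]
    [AddCommGroup M] [Module K M] [LinearOrder α] {v : α → M} {w : κ → M}
    (hw : LinearIndependent K w)
    (hv : ∀ a, v a ∉ Submodule.span K (v '' Set.Iio a ∪ Set.range w)) :
    LinearIndependent K (Sum.elim v w) := by
  classical
  rw [linearIndependent_iff']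
  intro s g hg
  rw [← s.toLeft_disjSum_toRight, Finset.sum_disjSum] at hg
  simp only [Sum.elim_inl, Sum.elim_inr] at hg
  have hleft : ∀ a ∈ s.toLeft, g (.inl a) = 0 := by
    by_contra! hcon
    obtain ⟨a, ha, hmax⟩ := (s.toLeft.filter fun a => g (.inl a) ≠ 0).exists_max_image id
      (by obtain ⟨a, ha, hga⟩ := hcon; exact ⟨a, Finset.mem_filter.2 ⟨ha, hga⟩⟩)
    obtain ⟨has, hga⟩ := Finset.mem_filter.1 ha
    refine hv a ((Submodule.smul_mem_iff _ hga).1 ?_)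
    rw [← Finset.add_sum_erase _ _ has, add_assoc] at hg
    rw [eq_neg_of_add_eq_zero_left hg]
    refine neg_mem (add_mem (sum_mem fun b hb => ?_) (sum_mem fun b _ => ?_))
    · obtain ⟨hba, hbs⟩ := Finset.mem_erase.1 hb
      by_cases hgb : g (.inl b) = 0
      · rw [hgb, zero_smul]
        exact zero_mem _
      · have hlt : b < a := lt_of_le_of_ne (hmax b (Finset.mem_filter.2 ⟨hbs, hgb⟩)) hba
        exact Submodule.smul_mem _ _ (Submodule.subset_span (.inl ⟨b, hlt, rfl⟩))
    · exact Submodule.smul_mem _ _ (Submodule.subset_span (.inr ⟨b, rfl⟩))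
  rw [Finset.sum_eq_zero fun a ha => by rw [hleft a ha, zero_smul], zero_add] at hg
  have hright := linearIndependent_iff'.1 hw _ _ hg
  rintro (a | b) hi
  · exact hleft a (Finset.mem_toLeft.2 hi)
  · exact hright b (Finset.mem_toRight.2 hi)

theorem mk_range_linearCombination_lt {M S : Type} [AddCommGroup M] [Module ℚ M] [Nonempty S]
    (hS : #S < 𝔠) (u : S → M) : #(Submodule.span ℚ (Set.range u)) < 𝔠 := by
  rw [← Finsupp.range_linearCombination]
  refine (mk_range_le (f := Finsupp.linearCombination ℚ u)).trans_lt ?_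
  rw [mk_finsupp_of_infinite', Cardinal.mkRat]
  exact max_lt hS aleph0_lt_continuum

/-- Almost disjoint permutations give distinct classes, because `f` is injective and sets in `U` are
infinite. So there are `𝔠` classes, and `W` cannot hold them all. -/
theorem exists_perm_ultraClass_notMem (hU : (U : Filter ℕ) ≤ cofinite) {f : ℕ → FreeAbCont}
    (hf : Function.Injective f) {W : Set ((U : Filter ℕ).Germ (ContIdx →₀ ℚ))} (hW : #W < 𝔠) :
    ∃ τ : Equiv.Perm ℕ, ultraClass U (f ∘ τ) ∉ W := by
  obtain ⟨s, hs⟩ := exists_perm_family_almost_disjoint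
  by_contra! hcon
  have hinj : Function.Injective fun r => (⟨ultraClass U (f ∘ s r), hcon (s r)⟩ : W) := by
    intro r r' hrr
    by_contra hne
    have h1 := ultraClass_eq_iff.1 (Subtype.mk_eq_mk.1 hrr)
    exact Ultrafilter.infinite_of_mem_of_le_cofinite hU (mem_of_superset h1 fun n hn => hf hn)
      (hs r r' hne)
  have := mk_le_of_injective hinj
  simp only [mk_pi, mk_bool, prod_const, mk_nat, lift_id, two_power_aleph0] at this
  exact absurd hW (not_lt.2 (by simpa using this))

theorem exists_isIndependentFamily (hU : (U : Filter ℕ) ≤ cofinite)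
    {h : ContIdxPos → ℕ → FreeAbCont} (hh : IsInjSeqEnumeration h) :
    ∃ σ, IsIndependentFamily U h σ := by
  have hinj : ∀ ξ, Function.Injective (h ξ) := fun ξ => by
    have : h ξ ∈ {f : ℕ → FreeAbCont | Function.Injective f} := hh.1 ▸ Set.mem_range_self ξ
    exact this
  -- Only the `χ_β` with `β < ξ` are put in the span to be avoided, which keeps its size below `𝔠`.
  obtain ⟨σ, hσ⟩ := exists_wellFounded_choice
    (fun (ξ : ContIdxPos) (r : ∀ η, η < ξ → Equiv.Perm ℕ) (τ : Equiv.Perm ℕ) =>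
      ultraClass U (h ξ ∘ τ) ∉ Submodule.span ℚ (Set.range
        (Sum.elim (fun η : Set.Iio ξ => ultraClass U (h η.1 ∘ r η.1 η.2))
          (fun β : Set.Iio ξ.1 => ultraClass U (fun _ => chi β.1)))))
    (fun ξ r => by
      obtain ⟨b, hb⟩ := not_isMin_iff.1 ξ.2
      have : Nonempty (Set.Iio ξ ⊕ Set.Iio ξ.1) := ⟨.inr ⟨b, hb⟩⟩
      refine exists_perm_ultraClass_notMem hU (hinj ξ) (mk_range_linearCombination_lt ?_ _)
      have h1 : #(Set.Iio ξ.1) < 𝔠 := mk_Iio_contIdx_lt ξ.1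
      have h2 : #(Set.Iio ξ) ≤ #(Set.Iio ξ.1) :=
        mk_le_of_injective (f := fun η : Set.Iio ξ => (⟨η.1.1, η.2⟩ : Set.Iio ξ.1))
          fun η η' hη => Subtype.ext (Subtype.ext (Subtype.mk_eq_mk.1 hη))
      rw [mk_sum, lift_id, lift_id]
      exact add_lt_of_lt aleph0_le_continuum (h2.trans_lt h1) h1)
  refine ⟨σ, linearIndependent_sumElim_of_notMem_span linearIndependent_ultraClass_chi
    fun ξ hξ => hσ ξ ?_⟩
  set W := Submodule.span ℚ (Set.range
    (Sum.elim (fun η : Set.Iio ξ => ultraClass U (h η.1 ∘ σ η.1))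
      (fun β : Set.Iio ξ.1 => ultraClass U (fun _ => chi β.1))))
  -- Truncation below `ξ` fixes the classes of the sequences up to `ξ` and kills `χ_β` for `β ≥ ξ`.
  -- Thus avoiding the small span already means avoiding the span with all `χ_β`.
  have hfix : ∀ η ≤ ξ, truncGerm U ξ.1 (ultraClass U (h η ∘ σ η)) = ultraClass U (h η ∘ σ η) :=
    fun η hη => by
      rw [truncGerm_ultraClass]
      congr 1
      ext1 n
      exact Finsupp.filter_eq_self_iff _ _ |>.2 fun β hβ =>
        (hh.2 η _ β (Finsupp.mem_support_iff.2 hβ)).trans_le hη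
  have hle : Submodule.span ℚ ((fun ξ => ultraClass U (h ξ ∘ σ ξ)) '' Set.Iio ξ ∪
      Set.range fun β : ContIdx => ultraClass U fun _ => chi β) ≤ W.comap (truncGerm U ξ.1) := by
    rw [Submodule.span_le]
    rintro _ (⟨η, hη, rfl⟩ | ⟨β, rfl⟩)
    · simp only [SetLike.mem_coe, Submodule.mem_comap]
      rw [hfix η (le_of_lt hη)]
      exact Submodule.subset_span ⟨.inl ⟨η, hη⟩, rfl⟩
    · simp only [SetLike.mem_coe, Submodule.mem_comap, truncGerm_ultraClass]
      by_cases hβ : β < ξ.1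
      · have : (chi β).filter (· < ξ.1) = chi β := Finsupp.filter_single_of_pos _ hβ
        rw [this]
        exact Submodule.subset_span ⟨.inr ⟨β, hβ⟩, rfl⟩
      · have : (chi β).filter (· < ξ.1) = 0 := Finsupp.filter_single_of_neg _ hβ
        rw [this, ultraClass_zero]
        exact W.zero_mem
  have := hle hξ
  rwa [Submodule.mem_comap, hfix ξ le_rfl] at this

end Independence

/-! ### The characters and the topology they induce. -/

section Main

variable {U : Ultrafilter ℕ} {h : ContIdxPos → ℕ → FreeAbCont} {σ : ContIdxPos → Equiv.Perm ℕ}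

theorem exists_hom_tendsto (hU : IsSelective U) (hh : IsInjSeqEnumeration h)
    (hσ : IsIndependentFamily U h σ) {J : FreeAbCont} (hJ : J ≠ 0) :
    ∃ φ : FreeAbCont →+ UnitAddCircle, φ J ≠ 0 ∧ ∀ ξ : ContIdxPos,
      Tendsto (fun n => φ (h ξ (σ ξ n))) (U : Filter ℕ) (𝓝 (φ (chi ξ.1))) := by
  obtain ⟨E, x, hJE, hE, hxJ, hx⟩ := hU.exists_tendsto_linearCombination_on
    (fun (ξ : ContIdxPos) n => h ξ (σ ξ n))
    (fun E ε hε => eventually_approxSolvable _ hσ.eventually_sum_ne_zero E hε) hJ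
  obtain ⟨y, hyx, hy⟩ := exists_tendsto_linearCombination_extension U
    (fun (ξ : ContIdxPos) n => h ξ (σ ξ n)) (fun ξ n => hh.2 ξ (σ ξ n)) E x hE hx
  refine ⟨(Finsupp.linearCombination ℤ y).toAddMonoidHom, ?_, fun ξ => ?_⟩
  · convert hxJ using 1
    simp only [LinearMap.toAddMonoidHom_coe, Finsupp.linearCombination_apply]
    exact Finsupp.sum_congr fun e he => by rw [hyx e (hJE e he)]
  · simpa [chi] using hy ξ

theorem isTopologicalAddGroup_initialTopology {ι : Type} (φ : ι → FreeAbCont →+ UnitAddCircle) :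
    @IsTopologicalAddGroup FreeAbCont (initialTopology φ) _ :=
  topologicalAddGroup_iInf fun i => topologicalAddGroup_induced (φ i)

theorem continuous_initialTopology {ι : Type} (φ : ι → FreeAbCont →+ UnitAddCircle) (i : ι) :
    @Continuous _ _ (initialTopology φ) _ (φ i) :=
  continuous_iInf_dom (i := i) continuous_induced_dom

/-- Distinct `x` and `y` are separated by the character attached to `x - y`. -/
theorem t2Space_initialTopology (φ : {J : FreeAbCont // J ≠ 0} → FreeAbCont →+ UnitAddCircle)
    (hφ : ∀ J, φ J J.1 ≠ 0) : @T2Space FreeAbCont (initialTopology φ) := by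
  let _ := initialTopology φ
  refine T2Space.of_injective_continuous (f := fun x J => φ J x) (fun x y hxy => ?_)
    (continuous_pi (continuous_initialTopology φ))
  by_contra hne
  refine hφ ⟨x - y, sub_ne_zero.2 hne⟩ ?_
  rw [map_sub, sub_eq_zero]
  exact congrFun hxy _

theorem tendsto_initialTopology {ι N : Type} {φ : ι → FreeAbCont →+ UnitAddCircle}
    {l : Filter N} {f : N → FreeAbCont} {a : FreeAbCont}
    (hf : ∀ i, Tendsto (fun n => φ i (f n)) l (𝓝 (φ i a))) :
    Tendsto f l (@nhds FreeAbCont (initialTopology φ) a) := by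
  rw [nhds_iInf, tendsto_iInf]
  intro i
  rw [nhds_induced, tendsto_comap_iff]
  exact hf i

/-- If every injective sequence has, after a permutation of its terms, a limit along a free
ultrafilter, then the space is countably compact. -/
theorem countablyCompactSpace_of_forall_tendsto_perm {X : Type*} [TopologicalSpace X] [T1Space X]
    (hU : (U : Filter ℕ) ≤ cofinite)
    (hX : ∀ f : ℕ → X, Function.Injective f →
      ∃ (τ : Equiv.Perm ℕ) (a : X), Tendsto (f ∘ τ) (U : Filter ℕ) (𝓝 a)) :
    CountablyCompactSpace X := by
  rw [← isCountablyCompact_univ_iff, isCountablyCompact_iff_infinite_subset_has_accPt]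
  intro B _ hB
  let f : ℕ → X := fun n => hB.natEmbedding B n
  have hf : Function.Injective f := Subtype.val_injective.comp (hB.natEmbedding B).injective
  obtain ⟨τ, a, ha⟩ := hX f hf
  -- If the limit `a` were not an accumulation point of `B`, the permuted sequence would equal `a`
  -- on a set in `U`, which is infinite, contrary to injectivity.
  refine ⟨a, Set.mem_univ a, accPt_iff_frequently.2 fun hcon => ?_⟩
  have h1 := ha.eventually hcon
  have h2 : ∀ᶠ n in (U : Filter ℕ), f (τ n) = a := h1.mono fun n hn => by
    by_contra hne
    exact hn ⟨hne, (hB.natEmbedding B (τ n)).2⟩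
  refine Ultrafilter.infinite_of_mem_of_le_cofinite hU h2 (Set.Subsingleton.finite ?_)
  intro m hm n hn
  exact τ.injective (hf (Eq.trans hm hn.symm))

theorem exists_hom_family (hU : IsSelective U) (hh : IsInjSeqEnumeration h)
    (hσ : IsIndependentFamily U h σ) :
    ∃ φ : {J : FreeAbCont // J ≠ 0} → FreeAbCont →+ UnitAddCircle,
      (∀ J, φ J J.1 ≠ 0) ∧
      (∀ J (ξ : ContIdxPos),
        Tendsto (fun n => φ J (h ξ (σ ξ n))) (U : Filter ℕ) (𝓝 (φ J (chi ξ.1)))) ∧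
      IsCountablyCompactGroupTopology (initialTopology φ) ∧
      ∀ ξ : ContIdxPos,
        Tendsto (fun n => h ξ (σ ξ n)) (U : Filter ℕ)
          (@nhds FreeAbCont (initialTopology φ) (chi ξ.1)) := by
  choose φ hφJ hφ using fun J : {J : FreeAbCont // J ≠ 0} => exists_hom_tendsto hU hh hσ J.2
  have hlim : ∀ ξ : ContIdxPos, Tendsto (fun n => h ξ (σ ξ n)) (U : Filter ℕ)
      (@nhds FreeAbCont (initialTopology φ) (chi ξ.1)) := fun ξ =>
    tendsto_initialTopology fun J => hφ J ξ
  have hT2 := t2Space_initialTopology φ hφJ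
  refine ⟨φ, hφJ, hφ, ⟨isTopologicalAddGroup_initialTopology φ, hT2, ?_⟩, hlim⟩
  let _ := initialTopology φ
  refine countablyCompactSpace_of_forall_tendsto_perm hU.1 fun f hf => ?_
  obtain ⟨ξ, rfl⟩ : f ∈ Set.range h := hh.1 ▸ hf
  exact ⟨σ ξ, chi ξ.1, hlim ξ⟩

end Main

theorem mainTheorem1 (U : Ultrafilter ℕ) (hU : IsSelective U) :
    (∃ τ : TopologicalSpace FreeAbCont, IsCountablyCompactGroupTopology τ) ∧
    (∃ h : ContIdxPos → ℕ → FreeAbCont, IsInjSeqEnumeration h) ∧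
    ∀ h : ContIdxPos → ℕ → FreeAbCont, IsInjSeqEnumeration h →
      (∃ σ : ContIdxPos → Equiv.Perm ℕ, IsIndependentFamily U h σ) ∧
      ∀ σ : ContIdxPos → Equiv.Perm ℕ, IsIndependentFamily U h σ →
        ∃ φ : {J : FreeAbCont // J ≠ 0} → FreeAbCont →+ UnitAddCircle,
          (∀ J, φ J J.1 ≠ 0) ∧
          (∀ J (ξ : ContIdxPos),
            Tendsto (fun n => φ J (h ξ (σ ξ n))) (U : Filter ℕ) (𝓝 (φ J (chi ξ.1)))) ∧
          IsCountablyCompactGroupTopology (initialTopology φ) ∧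
          ∀ ξ : ContIdxPos,
            Tendsto (fun n => h ξ (σ ξ n)) (U : Filter ℕ)
              (@nhds FreeAbCont (initialTopology φ) (chi ξ.1)) := by
  have hind : ∀ {h}, IsInjSeqEnumeration h → ∃ σ, IsIndependentFamily U h σ :=
    fun hh => exists_isIndependentFamily hU.1 hh
  refine ⟨?_, exists_isInjSeqEnumeration,
    fun h hh => ⟨hind hh, fun σ hσ => exists_hom_family hU hh hσ⟩⟩
  obtain ⟨h, hh⟩ := exists_isInjSeqEnumeration
  obtain ⟨σ, hσ⟩ := hind hh
  obtain ⟨φ, -, -, hφ, -⟩ := exists_hom_family hU hh hσ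
  exact ⟨_, hφ⟩
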